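/- Let $(\Omega,\mu)$ be an atomless measure space with $0<\mu(\Omega)<\infty$, and let $p,q:\Omega\to[1,\infty)$ be measurable functions (no boundedness is assumed) with $q(t)\le p(t)$ for $\mu$-almost every $t$. For a measurable exponent $r:\Omega\to[1,\infty)$ let $L^{r(\cdot)}(\mu)$ be the space of classes of real measurable functions $f$ on $\Omega$ such that $\int_\Omega |f(t)/\lambda|^{r(t)}\,d\mu<\infty$ for some $\lambda>0$, with the Luxemburg norm $\|f\|_{r(\cdot)}=\inf\{\lambda>0:\int_\Omega|f(t)/\lambda|^{r(t)}\,d\mu\le 1\}$. For a measurable $g:\Omega\to\mathbb R$ let $g^*(x)=\inf\{s\ge 0:\mu\{t:|g(t)|>s\}\le x\}$, $0\le x<\mu(\Omega)$, be its decreasing rearrangement. Suppose that the inclusion $L^{p(\cdot)}(\mu)\hookrightarrow L^{q(\cdot)}(\mu)$ is disjointly strictly singular (DSS), that is, there is no normalized sequence $(f_n)$ of pairwise disjoint elements of $L^{p(\cdot)}(\mu)$ such that the restriction of the inclusion to the closed linear span of $(f_n)$ in $L^{p(\cdot)}(\mu)$ is an isomorphism onto its image. Then $$\lim_{x\to\mu(\Omega)^-}\bigl(\mu(\Omega)-x\bigr)^{\left(\frac{p-q}{pq}\right)^*(x)}=0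 .$$ -/

import Mathlib

open MeasureTheory Set Filter Topology
open scoped ENNReal

noncomputable section

namespace VariableLebesgue

variable {Ω : Type*} [MeasurableSpace Ω]

/-- A measure is atomless (non-atomic): every measurable set of positive measure contains a
measurable subset of strictly smaller, positive measure. -/
def IsAtomless (μ : Measure Ω) : Prop :=
  ∀ s, MeasurableSet s → 0 < μ s → ∃ t, t ⊆ s ∧ MeasurableSet t ∧ 0 < μ t ∧ μ t < μ s

/-- The distribution function `μ_f(s) = μ {t : |f t| > s}`. -/
def distributionFunction (μ : Measure Ω) (f : Ω → ℝ) (s : ℝ) : ℝ≥0∞ :=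
  μ {t | s < |f t|}

/-- The decreasing rearrangement `f^*(x) = inf {s ≥ 0 : μ_f(s) ≤ x}`, considered for
`x ∈ [0, μ(Ω))`. -/
def decreasingRearrangement (μ : Measure Ω) (f : Ω → ℝ) (x : ℝ) : ℝ :=
  sInf {s : ℝ | 0 ≤ s ∧ distributionFunction μ f s ≤ ENNReal.ofReal x}

variable (Ω) in
/-- A variable exponent: a real measurable function `p` with `1 ≤ p(t) < ∞`. No upper bound is
imposed. -/
structure Exponent where
  toFun : Ω → ℝ
  measurable' : Measurable toFun
  one_le' : ∀ t, 1 ≤ toFun t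

instance : CoeFun (Exponent Ω) (fun _ => Ω → ℝ) := ⟨Exponent.toFun⟩

theorem Exponent.measurable (p : Exponent Ω) : Measurable (p : Ω → ℝ) := p.measurable'

theorem Exponent.one_le (p : Exponent Ω) (t : Ω) : 1 ≤ p t := p.one_le' t

theorem Exponent.pos (p : Exponent Ω) (t : Ω) : 0 < p t := zero_lt_one.trans_le (p.one_le t)

/-- The modular `ρ_{p(·)}(f) = ∫ |f(t)|^{p(t)} dμ`, with values in `[0, ∞]`. -/
def modular (p : Exponent Ω) (μ : Measure Ω) (f : Ω → ℝ) : ℝ≥0∞ :=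
  ∫⁻ t, ENNReal.ofReal (|f t| ^ p t) ∂μ

/-- The Luxemburg norm `‖f‖_{p(·)} = inf {r > 0 : ρ_{p(·)}(f / r) ≤ 1}`. -/
def luxemburgNorm (p : Exponent Ω) (μ : Measure Ω) (f : Ω → ℝ) : ℝ :=
  sInf {r : ℝ | 0 < r ∧ modular p μ (fun t => f t / r) ≤ 1}

variable {p q : Exponent Ω} {μ : Measure Ω}

theorem modular_mono {f g : Ω → ℝ} (h : ∀ᵐ t ∂μ, |f t| ≤ |g t|) :
    modular p μ f ≤ modular p μ g := by
  refine lintegral_mono_ae ?_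
  filter_upwards [h] with t ht
  exact ENNReal.ofReal_le_ofReal (Real.rpow_le_rpow (abs_nonneg _) ht (p.pos t).le)

theorem modular_congr {f g : Ω → ℝ} (h : ∀ᵐ t ∂μ, |f t| = |g t|) :
    modular p μ f = modular p μ g :=
  le_antisymm (modular_mono (h.mono fun _ ht => ht.le)) (modular_mono (h.mono fun _ ht => ht.ge))

theorem modular_const_mul_le {f : Ω → ℝ} {c : ℝ} (hc : 0 ≤ c) (hc1 : c ≤ 1) :
    modular p μ (fun t => c * f t) ≤ ENNReal.ofReal c * modular p μ f := by
  unfold modular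
  rw [← lintegral_const_mul' _ _ ENNReal.ofReal_ne_top]
  refine lintegral_mono fun t => ?_
  rw [← ENNReal.ofReal_mul hc]
  refine ENNReal.ofReal_le_ofReal ?_
  rw [abs_mul, abs_of_nonneg hc, Real.mul_rpow hc (abs_nonneg _)]
  refine mul_le_mul_of_nonneg_right ?_ (Real.rpow_nonneg (abs_nonneg _) _)
  rcases hc.eq_or_lt with rfl | hc'
  · rw [Real.zero_rpow (p.pos t).ne']
  · simpa using Real.rpow_le_rpow_of_exponent_ge hc' hc1 (p.one_le t)

theorem modular_convex {f g : Ω → ℝ} (hf : AEMeasurable f μ) {a b : ℝ} (ha : 0 ≤ a) (hb : 0 ≤ b)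
    (hab : a + b = 1) :
    modular p μ (fun t => a * f t + b * g t) ≤
      ENNReal.ofReal a * modular p μ f + ENNReal.ofReal b * modular p μ g := by
  unfold modular
  rw [← lintegral_const_mul' _ _ ENNReal.ofReal_ne_top,
    ← lintegral_const_mul' _ _ ENNReal.ofReal_ne_top, ← lintegral_add_left']
  · refine lintegral_mono fun t => ?_
    have h1 : 0 ≤ |f t| ^ p t := Real.rpow_nonneg (abs_nonneg _) _
    have h2 : 0 ≤ |g t| ^ p t := Real.rpow_nonneg (abs_nonneg _) _
    rw [← ENNReal.ofReal_mul ha, ← ENNReal.ofReal_mul hb,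
      ← ENNReal.ofReal_add (mul_nonneg ha h1) (mul_nonneg hb h2)]
    refine ENNReal.ofReal_le_ofReal ?_
    have h3 : |a * f t + b * g t| ≤ a * |f t| + b * |g t| := by
      refine (abs_add_le _ _).trans ?_
      rw [abs_mul, abs_mul, abs_of_nonneg ha, abs_of_nonneg hb]
    refine (Real.rpow_le_rpow (abs_nonneg _) h3 (p.pos t).le).trans ?_
    exact (convexOn_rpow (p.one_le t)).2 (abs_nonneg (f t)) (abs_nonneg (g t)) ha hb hab
  · exact (((hf.abs).pow p.measurable.aemeasurable).ennreal_ofReal).const_mul _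

theorem modular_zero : modular p μ (fun _ => 0) = 0 := by
  simp [modular, Real.zero_rpow (p.pos _).ne']

/-- If the modular of `f / r` is finite for some `r > 0`, it is at most `1` for some `r > 0`. -/
theorem exists_modular_le_one {f : Ω → ℝ}
    (h : ∃ r : ℝ, 0 < r ∧ modular p μ (fun t => f t / r) < ∞) :
    ∃ r : ℝ, 0 < r ∧ modular p μ (fun t => f t / r) ≤ 1 := by
  obtain ⟨r, hr, hf⟩ := h
  set M : ℝ := 1 + (modular p μ (fun t => f t / r)).toReal with hM
  have hM1 : 1 ≤ M := by simp [hM]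
  have hM0 : 0 < M := zero_lt_one.trans_le hM1
  refine ⟨r * M, mul_pos hr hM0, ?_⟩
  have h1 : (fun t => f t / (r * M)) = fun t => M⁻¹ * (f t / r) := by
    funext t; field_simp
  rw [h1]
  refine (modular_const_mul_le (inv_nonneg.2 hM0.le) (inv_le_one_of_one_le₀ hM1)).trans ?_
  rw [← ENNReal.ofReal_toReal hf.ne, ← ENNReal.ofReal_mul (inv_nonneg.2 hM0.le),
    ← ENNReal.ofReal_one]
  refine ENNReal.ofReal_le_ofReal ?_
  rw [inv_mul_le_iff₀ hM0]
  simp [hM]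

theorem luxemburgNorm_nonneg (f : Ω → ℝ) : 0 ≤ luxemburgNorm p μ f :=
  Real.sInf_nonneg fun _ hr => hr.1.le

theorem luxemburgNorm_le {f : Ω → ℝ} {r : ℝ} (hr : 0 < r)
    (h : modular p μ (fun t => f t / r) ≤ 1) : luxemburgNorm p μ f ≤ r :=
  csInf_le ⟨0, fun _ hs => hs.1.le⟩ ⟨hr, h⟩

theorem luxemburgNorm_congr {f g : Ω → ℝ} (h : ∀ᵐ t ∂μ, |f t| = |g t|) :
    luxemburgNorm p μ f = luxemburgNorm p μ g := by
  have : ∀ r : ℝ, modular p μ (fun t => f t / r) = modular p μ (fun t => g t / r) := fun r =>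
    modular_congr (h.mono fun t ht => by rw [abs_div, abs_div, ht])
  simp only [luxemburgNorm, this]

theorem modular_div_le_one {f : Ω → ℝ}
    (hf : ∃ r : ℝ, 0 < r ∧ modular p μ (fun t => f t / r) < ∞) {r : ℝ}
    (h : luxemburgNorm p μ f < r) : modular p μ (fun t => f t / r) ≤ 1 := by
  obtain ⟨s, ⟨hs, hs1⟩, hsr⟩ := exists_lt_of_csInf_lt (exists_modular_le_one hf) h
  refine (modular_mono (Eventually.of_forall fun t => ?_)).trans hs1
  rw [abs_div, abs_div, abs_of_pos hs, abs_of_pos (hs.trans hsr)]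
  exact div_le_div_of_nonneg_left (abs_nonneg _) hs hsr.le

theorem modular_add_div_le {f g : Ω → ℝ} (hf : AEMeasurable f μ) {r s : ℝ} (hr : 0 < r)
    (hs : 0 < s) :
    modular p μ (fun t => (f t + g t) / (r + s)) ≤
      ENNReal.ofReal (r / (r + s)) * modular p μ (fun t => f t / r) +
      ENNReal.ofReal (s / (r + s)) * modular p μ (fun t => g t / s) := by
  have h0 : 0 < r + s := add_pos hr hs
  have h1 : (fun t => (f t + g t) / (r + s)) =
      fun t => r / (r + s) * (f t / r) + s / (r + s) * (g t / s) := by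
    funext t; field_simp
  rw [h1]
  exact modular_convex (hf.div_const r) (div_pos hr h0).le (div_pos hs h0).le (by field_simp)

variable (p μ) in
/-- The variable Lebesgue (Nakano) space `L^{p(·)}(μ)`: the classes (modulo a.e. equality) of real
measurable functions `f` such that `ρ_{p(·)}(f / r) < ∞` for some `r > 0`. -/
def varLp : Submodule ℝ (Ω →ₘ[μ] ℝ) where
  carrier := {f | ∃ r : ℝ, 0 < r ∧ modular p μ (fun t => f t / r) < ∞}
  zero_mem' := by
    refine ⟨1, one_pos, ?_⟩
    have : modular p μ (fun t => (0 : Ω →ₘ[μ] ℝ) t / 1) = modular p μ (fun _ => 0) :=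
      modular_congr ((AEEqFun.coeFn_zero (α := Ω) (μ := μ) (β := ℝ)).mono fun t ht => by
        rw [ht, Pi.zero_apply, zero_div])
    rw [this, modular_zero]
    exact ENNReal.zero_lt_top
  add_mem' := by
    rintro f g ⟨r, hr, hf⟩ ⟨s, hs, hg⟩
    refine ⟨r + s, add_pos hr hs, ?_⟩
    have : modular p μ (fun t => (f + g) t / (r + s)) =
        modular p μ (fun t => (f t + g t) / (r + s)) :=
      modular_congr ((AEEqFun.coeFn_add f g).mono fun t ht => by simp [ht])
    rw [this]
    refine (modular_add_div_le f.aestronglyMeasurable.aemeasurable hr hs).trans_lt ?_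
    exact ENNReal.add_lt_top.2 ⟨ENNReal.mul_lt_top ENNReal.ofReal_lt_top hf,
      ENNReal.mul_lt_top ENNReal.ofReal_lt_top hg⟩
  smul_mem' := by
    rintro c f ⟨r, hr, hf⟩
    refine ⟨(|c| + 1) * r, by positivity, ?_⟩
    refine (modular_mono ((AEEqFun.coeFn_smul c f).mono fun t ht => ?_)).trans_lt hf
    rw [ht, Pi.smul_apply, smul_eq_mul, abs_div, abs_div, abs_mul, abs_mul, abs_of_pos hr,
      abs_of_pos (show (0 : ℝ) < |c| + 1 by positivity)]
    rw [div_le_div_iff₀ (by positivity) hr]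
    have := mul_nonneg (abs_nonneg (f t)) hr.le
    nlinarith

theorem mem_varLp {f : Ω →ₘ[μ] ℝ} :
    f ∈ varLp p μ ↔ ∃ r : ℝ, 0 < r ∧ modular p μ (fun t => f t / r) < ∞ := Iff.rfl

/-- `L^{p(·)}(μ)` is an ideal of the lattice of classes of measurable functions. -/
theorem mem_varLp_of_abs_le {f g : Ω →ₘ[μ] ℝ} (hg : g ∈ varLp p μ)
    (h : ∀ᵐ t ∂μ, |f t| ≤ |g t|) : f ∈ varLp p μ := by
  obtain ⟨r, hr, hg⟩ := hg
  refine ⟨r, hr, (modular_mono (h.mono fun t ht => ?_)).trans_lt hg⟩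
  rw [abs_div, abs_div]
  exact div_le_div_of_nonneg_right ht (abs_nonneg _)

theorem abs_mem_varLp {f : Ω →ₘ[μ] ℝ} (hf : f ∈ varLp p μ) : |f| ∈ varLp p μ :=
  mem_varLp_of_abs_le hf ((AEEqFun.coeFn_abs f).mono fun t ht => by rw [ht, abs_abs])

theorem sup_mem_varLp {f g : Ω →ₘ[μ] ℝ} (hf : f ∈ varLp p μ) (hg : g ∈ varLp p μ) :
    f ⊔ g ∈ varLp p μ := by
  refine mem_varLp_of_abs_le (add_mem (abs_mem_varLp hf) (abs_mem_varLp hg)) ?_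
  filter_upwards [AEEqFun.coeFn_sup f g, AEEqFun.coeFn_add |f| |g|, AEEqFun.coeFn_abs f,
    AEEqFun.coeFn_abs g] with t h1 h2 h3 h4
  rw [h1, h2, Pi.add_apply, h3, h4, abs_of_nonneg (add_nonneg (abs_nonneg (f t)) (abs_nonneg _))]
  have ha := abs_nonneg (f t)
  have hb := abs_nonneg (g t)
  rcases max_choice (f t) (g t) with h | h <;> rw [h] <;> linarith

theorem inf_mem_varLp {f g : Ω →ₘ[μ] ℝ} (hf : f ∈ varLp p μ) (hg : g ∈ varLp p μ) :
    f ⊓ g ∈ varLp p μ := by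
  refine mem_varLp_of_abs_le (add_mem (abs_mem_varLp hf) (abs_mem_varLp hg)) ?_
  filter_upwards [AEEqFun.coeFn_inf f g, AEEqFun.coeFn_add |f| |g|, AEEqFun.coeFn_abs f,
    AEEqFun.coeFn_abs g] with t h1 h2 h3 h4
  rw [h1, h2, Pi.add_apply, h3, h4, abs_of_nonneg (add_nonneg (abs_nonneg (f t)) (abs_nonneg _))]
  have ha := abs_nonneg (f t)
  have hb := abs_nonneg (g t)
  rcases min_choice (f t) (g t) with h | h <;> rw [h] <;> linarith

/-- The a.e. pointwise lattice structure of `L^{p(·)}(μ)`. -/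
instance : Lattice (varLp p μ) :=
  Subtype.lattice (fun {_ _} hf hg => sup_mem_varLp hf hg) (fun {_ _} hf hg => inf_mem_varLp hf hg)

theorem luxemburgNorm_add_le {f g : Ω →ₘ[μ] ℝ} (hf : f ∈ varLp p μ) (hg : g ∈ varLp p μ) :
    luxemburgNorm p μ (f + g : Ω →ₘ[μ] ℝ) ≤ luxemburgNorm p μ f + luxemburgNorm p μ g := by
  refine le_of_forall_pos_le_add fun ε hε => ?_
  have hr : luxemburgNorm p μ f < luxemburgNorm p μ f + ε / 2 := by linarith
  have hs : luxemburgNorm p μ g < luxemburgNorm p μ g + ε / 2 := by linarith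
  have hr0 := (luxemburgNorm_nonneg (p := p) (μ := μ) f).trans_lt hr
  have hs0 := (luxemburgNorm_nonneg (p := p) (μ := μ) g).trans_lt hs
  have hr1 := modular_div_le_one hf hr
  have hs1 := modular_div_le_one hg hs
  set r := luxemburgNorm p μ f + ε / 2 with hrdef
  set s := luxemburgNorm p μ g + ε / 2 with hsdef
  have h0 : 0 < r + s := add_pos hr0 hs0
  have : luxemburgNorm p μ (f + g : Ω →ₘ[μ] ℝ) ≤ r + s := by
    refine luxemburgNorm_le h0 ?_
    rw [modular_congr (g := fun t => (f t + g t) / (r + s))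
      ((AEEqFun.coeFn_add f g).mono fun t ht => by simp [ht])]
    refine (modular_add_div_le f.aestronglyMeasurable.aemeasurable hr0 hs0).trans ?_
    calc _ ≤ ENNReal.ofReal (r / (r + s)) * 1 + ENNReal.ofReal (s / (r + s)) * 1 := by gcongr
      _ = 1 := by
        rw [mul_one, mul_one, ← ENNReal.ofReal_add (by positivity) (by positivity), ← add_div,
          div_self h0.ne', ENNReal.ofReal_one]
  linarith

theorem eq_zero_of_luxemburgNorm_eq_zero {f : Ω →ₘ[μ] ℝ} (hf : f ∈ varLp p μ)
    (h : luxemburgNorm p μ f = 0) : f = 0 := by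
  have h1 : ∀ c : ℝ, 0 < c → c ≤ 1 → modular p μ f ≤ ENNReal.ofReal c := fun c hc hc1 => by
    have h2 := modular_div_le_one hf (h.trans_lt hc)
    have h3 : modular p μ f = modular p μ (fun t => c * (f t / c)) := by
      congr 1; funext t; field_simp
    rw [h3]
    refine (modular_const_mul_le hc.le hc1).trans ?_
    calc _ ≤ ENNReal.ofReal c * 1 := by gcongr
      _ = _ := mul_one _
  have h2 : modular p μ f = 0 := by
    refine le_antisymm (ENNReal.le_of_forall_pos_le_add fun ε hε _ => ?_) bot_le
    refine (h1 (min ε 1) (lt_min hε one_pos) (min_le_right _ _)).trans ?_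
    rw [zero_add]
    refine (ENNReal.ofReal_le_ofReal (min_le_left _ _)).trans ?_
    rw [ENNReal.ofReal_coe_nnreal]
  have hm : AEMeasurable (fun t => ENNReal.ofReal (|f t| ^ p t)) μ :=
    ((f.aestronglyMeasurable.aemeasurable.abs).pow p.measurable.aemeasurable).ennreal_ofReal
  rw [modular, lintegral_eq_zero_iff' hm] at h2
  refine AEEqFun.ext ?_
  filter_upwards [h2, AEEqFun.coeFn_zero (α := Ω) (μ := μ) (β := ℝ)] with t ht h0
  rw [h0, Pi.zero_apply]
  have h3 : |f t| ^ p t ≤ 0 := ENNReal.ofReal_eq_zero.1 ht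
  have h4 := le_antisymm h3 (Real.rpow_nonneg (abs_nonneg _) _)
  exact abs_eq_zero.1 ((Real.rpow_eq_zero (abs_nonneg _) (p.pos t).ne').1 h4)

/-- `L^{p(·)}(μ)` is a normed space with the Luxemburg norm. -/
instance : NormedAddCommGroup (varLp p μ) :=
  AddGroupNorm.toNormedAddCommGroup
    { toFun := fun f => luxemburgNorm p μ (f : Ω →ₘ[μ] ℝ)
      map_zero' := by
        refine le_antisymm (le_of_forall_pos_le_add fun ε hε => ?_) (luxemburgNorm_nonneg _)
        rw [zero_add]
        refine luxemburgNorm_le hε ?_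
        rw [modular_congr (g := fun _ => 0)
          ((AEEqFun.coeFn_zero (α := Ω) (μ := μ) (β := ℝ)).mono fun t ht => by
            rw [Submodule.coe_zero, ht, Pi.zero_apply, zero_div]), modular_zero]
        exact zero_le_one
      add_le' := fun f g => luxemburgNorm_add_le f.2 g.2
      neg' := fun f => luxemburgNorm_congr
        ((AEEqFun.coeFn_neg (f : Ω →ₘ[μ] ℝ)).mono fun t ht => by
          simp only [Submodule.coe_neg, ht, Pi.neg_apply, abs_neg])
      eq_zero_of_map_eq_zero' := fun f hf =>
        Subtype.ext (eq_zero_of_luxemburgNorm_eq_zero f.2 hf) }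

theorem norm_def (f : varLp p μ) : ‖f‖ = luxemburgNorm p μ (f : Ω →ₘ[μ] ℝ) := rfl

instance : NormedSpace ℝ (varLp p μ) where
  norm_smul_le c f := by
    rw [norm_def, norm_def, Real.norm_eq_abs]
    refine le_of_forall_pos_le_add fun ε hε => ?_
    have hδ : 0 < ε / (|c| + 1) := by positivity
    have hr : luxemburgNorm p μ (f : Ω →ₘ[μ] ℝ) <
        luxemburgNorm p μ (f : Ω →ₘ[μ] ℝ) + ε / (|c| + 1) := by linarith
    have hr0 := (luxemburgNorm_nonneg (p := p) (μ := μ) (f : Ω →ₘ[μ] ℝ)).trans_lt hr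
    have hr1 := modular_div_le_one f.2 hr
    have hεc : |c| * (ε / (|c| + 1)) < ε := by
      rw [← mul_div_assoc, div_lt_iff₀ (by positivity)]; nlinarith [abs_nonneg c]
    set N := luxemburgNorm p μ (f : Ω →ₘ[μ] ℝ) with hN
    have hN0 : 0 ≤ N := luxemburgNorm_nonneg _
    have hpos : 0 < |c| * N + ε := by positivity
    refine luxemburgNorm_le hpos ((modular_mono ?_).trans hr1)
    filter_upwards [AEEqFun.coeFn_smul c (f : Ω →ₘ[μ] ℝ)] with t ht
    rw [Submodule.coe_smul, ht, Pi.smul_apply, smul_eq_mul, abs_div, abs_div, abs_mul,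
      abs_of_pos hpos, abs_of_pos hr0, div_le_div_iff₀ hpos hr0]
    have := abs_nonneg ((f : Ω →ₘ[μ] ℝ) t)
    nlinarith [mul_le_mul_of_nonneg_left hεc.le this]

instance : IsOrderedAddMonoid (varLp p μ) where
  add_le_add_left f g h k := by
    have h' : (f : Ω →ₘ[μ] ℝ) ≤ g := h
    change (f : Ω →ₘ[μ] ℝ) + k ≤ (g : Ω →ₘ[μ] ℝ) + k
    rw [← AEEqFun.coeFn_le] at h' ⊢
    filter_upwards [h', AEEqFun.coeFn_add (f : Ω →ₘ[μ] ℝ) k,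
      AEEqFun.coeFn_add (g : Ω →ₘ[μ] ℝ) k] with t h1 h2 h3
    rw [h2, h3, Pi.add_apply, Pi.add_apply]
    exact add_le_add h1 le_rfl

/-- The Luxemburg norm is a lattice norm. -/
instance : HasSolidNorm (varLp p μ) where
  solid f g h := by
    have h' : |(f : Ω →ₘ[μ] ℝ)| ≤ |(g : Ω →ₘ[μ] ℝ)| := h
    have hle : ∀ᵐ t ∂μ, |(f : Ω →ₘ[μ] ℝ) t| ≤ |(g : Ω →ₘ[μ] ℝ) t| := by
      filter_upwards [AEEqFun.coeFn_le.2 h', AEEqFun.coeFn_abs (f : Ω →ₘ[μ] ℝ),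
        AEEqFun.coeFn_abs (g : Ω →ₘ[μ] ℝ)] with t h1 h2 h3
      rwa [h2, h3] at h1
    rw [norm_def, norm_def]
    refine le_of_forall_gt_imp_ge_of_dense fun r hr => ?_
    have hr0 := (luxemburgNorm_nonneg (p := p) (μ := μ) (g : Ω →ₘ[μ] ℝ)).trans_lt hr
    refine luxemburgNorm_le hr0 ((modular_mono (hle.mono fun t ht => ?_)).trans
      (modular_div_le_one g.2 hr))
    rw [abs_div, abs_div]
    exact div_le_div_of_nonneg_right ht (abs_nonneg _)

theorem modular_le_of_exponent_le [IsFiniteMeasure μ] (hqp : ∀ᵐ t ∂μ, q t ≤ p t) (f : Ω → ℝ) :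
    modular q μ f ≤ μ univ + modular p μ f := by
  have : μ univ = ∫⁻ _, 1 ∂μ := by simp
  unfold modular
  rw [this, ← lintegral_add_left measurable_const]
  refine lintegral_mono_ae ?_
  filter_upwards [hqp] with t ht
  rcases le_total |f t| 1 with h | h
  · refine le_add_right ?_
    rw [← ENNReal.ofReal_one]
    exact ENNReal.ofReal_le_ofReal (Real.rpow_le_one (abs_nonneg _) h (q.pos t).le)
  · exact le_add_left (ENNReal.ofReal_le_ofReal (Real.rpow_le_rpow_of_exponent_le h ht))

theorem varLp_le [IsFiniteMeasure μ] (hqp : ∀ᵐ t ∂μ, q t ≤ p t) : varLp p μ ≤ varLp q μ := by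
  rintro f ⟨r, hr, hf⟩
  exact ⟨r, hr, (modular_le_of_exponent_le hqp _).trans_lt
    (ENNReal.add_lt_top.2 ⟨measure_lt_top μ _, hf⟩)⟩

theorem luxemburgNorm_le_of_exponent_le [IsFiniteMeasure μ] (hqp : ∀ᵐ t ∂μ, q t ≤ p t)
    {f : Ω →ₘ[μ] ℝ} (hf : f ∈ varLp p μ) :
    luxemburgNorm q μ f ≤ (μ.real univ + 1) * luxemburgNorm p μ f := by
  have hM : 0 < μ.real univ + 1 := by positivity
  rw [← div_le_iff₀' hM]
  refine le_of_forall_gt_imp_ge_of_dense fun r hr => ?_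
  have hr0 := (luxemburgNorm_nonneg (p := p) (μ := μ) f).trans_lt hr
  rw [div_le_iff₀' hM]
  refine luxemburgNorm_le (mul_pos hM hr0) ?_
  have h1 : (fun t => f t / ((μ.real univ + 1) * r)) =
      fun t => (μ.real univ + 1)⁻¹ * (f t / r) := by
    funext t; field_simp
  rw [h1]
  refine (modular_const_mul_le (inv_nonneg.2 hM.le)
    (inv_le_one_of_one_le₀ (by simp))).trans ?_
  have h2 : modular q μ (fun t => f t / r) ≤ ENNReal.ofReal (μ.real univ + 1) := by
    refine (modular_le_of_exponent_le hqp _).trans ?_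
    rw [ENNReal.ofReal_add measureReal_nonneg zero_le_one, ENNReal.ofReal_one,
      ofReal_measureReal]
    gcongr
    exact modular_div_le_one hf hr
  calc _ ≤ ENNReal.ofReal (μ.real univ + 1)⁻¹ * ENNReal.ofReal (μ.real univ + 1) := by gcongr
    _ = 1 := by
      rw [← ENNReal.ofReal_mul (inv_nonneg.2 hM.le), inv_mul_cancel₀ hM.ne', ENNReal.ofReal_one]

/-- The inclusion operator `L^{p(·)}(μ) ↪ L^{q(·)}(μ)`, `f ↦ f`, for a finite measure and
`q ≤ p` a.e. -/
def inclusion [IsFiniteMeasure μ] (hqp : ∀ᵐ t ∂μ, q t ≤ p t) : varLp p μ →L[ℝ] varLp q μ :=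
  (Submodule.inclusion (varLp_le hqp)).mkContinuous (μ.real univ + 1)
    fun f => luxemburgNorm_le_of_exponent_le hqp f.2

theorem coe_inclusion [IsFiniteMeasure μ] (hqp : ∀ᵐ t ∂μ, q t ≤ p t) (f : varLp p μ) :
    (inclusion hqp f : Ω →ₘ[μ] ℝ) = f := rfl

/-- A bounded operator `T` is an isomorphism (onto its image) on the subspace `M`. -/
def IsIsomorphismOn {E F : Type*} [NormedAddCommGroup E] [NormedSpace ℝ E]
    [NormedAddCommGroup F] [NormedSpace ℝ F] (T : E →L[ℝ] F) (M : Submodule ℝ E) : Prop :=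
  ∃ c : ℝ, 0 < c ∧ ∀ x ∈ M, c * ‖x‖ ≤ ‖T x‖

/-- A bounded operator `T` on a normed lattice `E` is disjointly strictly singular (DSS) if there
is no normalized pairwise disjoint sequence `(f n)` in `E` such that the restriction of `T` to the
closed linear span of `(f n)` is an isomorphism. -/
def IsDSS {E F : Type*} [NormedAddCommGroup E] [NormedSpace ℝ E] [Lattice E]
    [IsOrderedAddMonoid E] [HasSolidNorm E] [NormedAddCommGroup F] [NormedSpace ℝ F] (T : E →L[ℝ] F) : Prop :=
  ∀ f : ℕ → E, (∀ n, ‖f n‖ = 1) → (Pairwise fun m n => |f m| ⊓ |f n| = 0) →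
    ¬ IsIsomorphismOn T (Submodule.span ℝ (Set.range f)).topologicalClosure

end VariableLebesgue

end

/-! Put `f = (p - q) / (p q) = 1/q - 1/p`, so that `0 ≤ f ≤ 1` a.e. The proof is by contraposition:
if the limit fails, a disjoint sequence is built on whose closed span the inclusion is an
isomorphism.

The engine is a lower bound `μ(B k) ^ f ≥ δ > 0` on disjoint sets `B k` of positive measure. The
bumps `μ(B k) ^ (-1/p)` on `B k` have `p`-norm one. For `F = ∑ a k • bump k`, the density `|F|^q` on
`B k` is `(|a k| μ(B k)^f)^q / μ(B k) ≥ (|a k| δ)^q / μ(B k)`, while `|δ F|^p` is `(|a k| δ)^p / μ(B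
k)`. After scaling `F` to have `q`-modular at most one, each `|a k| δ` is at most one, so passing
from `q` to the larger `p` only decreases the power. Hence `δ ‖F‖_p ≤ ‖F‖_q`
(`luxemburgNorm_le_of_normalizedBump`, `not_isDSS_inclusion`). No bound on the exponents enters.

To find the sets, failure of the limit yields arbitrarily small `y`, each with a level `s` such that
`y ^ s` stays bounded below and `μ {f ≤ s} ≥ y`. If `{f = 0}` has positive measure, any disjoint
pieces of it serve with `δ = 1`. Otherwise the measures of these sublevel sets tend to zero, and
differences of a rapidly shrinking sequence of them serve
(`IsAtomless.exists_disjoint_seq_le_rpow`). -/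

namespace VariableLebesgue

variable {Ω : Type*} [MeasurableSpace Ω] {p q : Exponent Ω} {μ : Measure Ω}

/-! ### Normalized bumps and the norm comparison on their span -/

/-- The function `μ(B)^{-1/p(t)}` on `B`, extended by zero; its `p(·)`-modular is `1`. -/
noncomputable def normalizedBump (p : Exponent Ω) (μ : Measure Ω) (B : Set Ω) : Ω → ℝ :=
  B.indicator fun t => μ.real B ^ (-(p t)⁻¹)

theorem measurable_normalizedBump {B : Set Ω} (hB : MeasurableSet B) :
    Measurable (normalizedBump p μ B) :=
  (measurable_const.pow p.measurable.inv.neg).indicator hB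

theorem modular_normalizedBump [IsFiniteMeasure μ] {B : Set Ω} (hB : MeasurableSet B)
    (hpos : 0 < μ.real B) : modular p μ (normalizedBump p μ B) = 1 := by
  have h : ∀ t, ENNReal.ofReal (|normalizedBump p μ B t| ^ p t) =
      B.indicator (fun _ => ENNReal.ofReal (μ.real B)⁻¹) t := fun t => by
    by_cases ht : t ∈ B
    · rw [normalizedBump, indicator_of_mem ht, indicator_of_mem ht,
        abs_of_pos (Real.rpow_pos_of_pos hpos _), ← Real.rpow_mul hpos.le, neg_mul,
        inv_mul_cancel₀ (p.pos t).ne', Real.rpow_neg_one]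
    · rw [normalizedBump, indicator_of_notMem ht, indicator_of_notMem ht, abs_zero,
        Real.zero_rpow (p.pos t).ne', ENNReal.ofReal_zero]
  simp_rw [modular, h]
  rw [lintegral_indicator_const hB, ← ofReal_measureReal, ← ENNReal.ofReal_mul (by positivity),
    inv_mul_cancel₀ hpos.ne', ENNReal.ofReal_one]

/-- A norm below one would give some `r < 1` with `ρ(f / r) ≤ 1`, and convexity yields `ρ(f) ≤ r ρ(f
/ r) < 1`. This avoids continuity of the modular in `r`, which may fail for unbounded exponents. -/
theorem luxemburgNorm_eq_one_of_modular_eq_one {f : Ω → ℝ} (h : modular p μ f = 1) :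
    luxemburgNorm p μ f = 1 := by
  have h1 : modular p μ (fun t => f t / 1) = 1 := by simpa using h
  refine le_antisymm (luxemburgNorm_le one_pos h1.le) (le_of_not_gt fun hlt => ?_)
  obtain ⟨r, hr, hr1⟩ := exists_between hlt
  have hr0 : 0 < r := (luxemburgNorm_nonneg f).trans_lt hr
  have h2 := modular_div_le_one ⟨1, one_pos, h1.trans_lt ENNReal.one_lt_top⟩ hr
  have h3 : modular p μ f ≤ ENNReal.ofReal r * 1 := by
    have : f = fun t => r * (f t / r) := by funext t; field_simp
    conv_lhs => rw [this]
    exact (modular_const_mul_le hr0.le hr1.le).trans (by gcongr)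
  rw [h, mul_one, ENNReal.one_le_ofReal] at h3
  exact absurd h3 hr1.not_ge

/-- The exponent identity `-q/p = q (p - q)/(p q) - 1` splits off the factor `m⁻¹`, which cancels
the measure of the set on integration. -/
theorem rpow_mul_inv_le_abs_mul_rpow {m δ a p q : ℝ} (hm : 0 < m) (hδ : 0 ≤ δ) (hp : 0 < p)
    (hq : 0 < q) (h : δ ≤ m ^ ((p - q) / (p * q))) :
    (|a| * δ) ^ q * m⁻¹ ≤ |a * m ^ (-p⁻¹)| ^ q := by
  have h1 : |a * m ^ (-p⁻¹)| ^ q = (|a| * m ^ ((p - q) / (p * q))) ^ q * m⁻¹ := by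
    rw [abs_mul, abs_of_pos (Real.rpow_pos_of_pos hm _), Real.mul_rpow (abs_nonneg _)
      (Real.rpow_pos_of_pos hm _).le, Real.mul_rpow (abs_nonneg _)
      (Real.rpow_pos_of_pos hm _).le, ← Real.rpow_mul hm.le, ← Real.rpow_mul hm.le, mul_assoc,
      ← Real.rpow_neg_one m, ← Real.rpow_add hm]
    congr 2
    field_simp
    ring
  rw [h1]
  gcongr

theorem abs_div_mul_rpow {m δ a r p : ℝ} (hm : 0 < m) (hδ : 0 ≤ δ) (hp : 0 < p) :
    |δ * (a * m ^ (-p⁻¹) / r)| ^ p = (|a / r| * δ) ^ p * m⁻¹ := by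
  have h1 : |δ * (a * m ^ (-p⁻¹) / r)| = |a / r| * δ * m ^ (-p⁻¹) := by
    rw [show δ * (a * m ^ (-p⁻¹) / r) = (a / r) * δ * m ^ (-p⁻¹) by ring, abs_mul, abs_mul,
      abs_of_nonneg hδ, abs_of_pos (Real.rpow_pos_of_pos hm _)]
  rw [h1, Real.mul_rpow (by positivity) (by positivity), ← Real.rpow_mul hm.le, neg_mul,
    inv_mul_cancel₀ hp.ne', Real.rpow_neg_one]

/-- A function which is a multiple of `normalizedBump p μ (B k)` on each of the disjoint sets
`B k` and vanishes elsewhere has `p(·)`-norm controlled by its `q(·)`-norm. -/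
theorem luxemburgNorm_le_of_normalizedBump [IsFiniteMeasure μ] (hqp : ∀ᵐ t ∂μ, q t ≤ p t)
    {B : ℕ → Set Ω} (hB : ∀ k, MeasurableSet (B k)) (hpos : ∀ k, 0 < μ.real (B k)) {δ : ℝ}
    (hδ : 0 < δ)
    (h : ∀ k, ∀ᵐ t ∂μ, t ∈ B k → δ ≤ μ.real (B k) ^ ((p t - q t) / (p t * q t)))
    {F : Ω → ℝ} {a : ℕ → ℝ} (hF : ∀ k, ∀ᵐ t ∂μ, t ∈ B k → F t = a k * normalizedBump p μ (B k) t)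
    (hF0 : ∀ᵐ t ∂μ, t ∉ ⋃ k, B k → F t = 0)
    (hFq : ∃ r : ℝ, 0 < r ∧ modular q μ (fun t => F t / r) < ∞) :
    δ * luxemburgNorm p μ F ≤ luxemburgNorm q μ F := by
  refine le_of_forall_gt_imp_ge_of_dense fun r hr => ?_
  have hr0 : 0 < r := (luxemburgNorm_nonneg F).trans_lt hr
  have hr1 := modular_div_le_one hFq hr
  have key : ∀ k, ∀ᵐ t ∂μ, t ∈ B k →
      (|a k / r| * δ) ^ q t * (μ.real (B k))⁻¹ ≤ |F t / r| ^ q t := fun k => by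
    filter_upwards [h k, hF k] with t h1 h2 ht
    rw [h2 ht, normalizedBump, indicator_of_mem ht, mul_div_right_comm]
    exact rpow_mul_inv_le_abs_mul_rpow (hpos k) hδ.le (p.pos t) (q.pos t) (h1 ht)
  -- If this failed, `q ≥ 1` would make the `q`-modular over `B k` alone at least `|a k / r| * δ >
  -- 1`.
  have hc : ∀ k, |a k / r| * δ ≤ 1 := fun k => by
    by_contra! hlt
    have h1 : ENNReal.ofReal (|a k / r| * δ) ≤ 1 := by
      calc ENNReal.ofReal (|a k / r| * δ)
          = ENNReal.ofReal (|a k / r| * δ * (μ.real (B k))⁻¹) * μ (B k) := by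
            rw [← ofReal_measureReal (μ := μ) (s := B k), ← ENNReal.ofReal_mul
              (mul_nonneg (by positivity) (inv_nonneg.2 (hpos k).le)), mul_assoc,
              inv_mul_cancel₀ (hpos k).ne', mul_one]
        _ = ∫⁻ t, (B k).indicator
              (fun _ => ENNReal.ofReal (|a k / r| * δ * (μ.real (B k))⁻¹)) t ∂μ :=
            (lintegral_indicator_const (hB k) _).symm
        _ ≤ modular q μ (fun t => F t / r) := by
            refine lintegral_mono_ae ?_
            filter_upwards [key k] with t h1
            by_cases ht : t ∈ B k
            · rw [indicator_of_mem ht]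
              refine ENNReal.ofReal_le_ofReal (le_trans ?_ (h1 ht))
              refine mul_le_mul_of_nonneg_right ?_ (inv_nonneg.2 (hpos k).le)
              exact Real.self_le_rpow_of_one_le hlt.le (q.one_le t)
            · rw [indicator_of_notMem ht]
              exact zero_le
        _ ≤ 1 := hr1
    exact absurd (ENNReal.ofReal_le_one.1 h1) hlt.not_ge
  have h1 : modular p μ (fun t => δ * (F t / r)) ≤ modular q μ (fun t => F t / r) := by
    refine lintegral_mono_ae ?_
    filter_upwards [hqp, ae_all_iff.2 key, ae_all_iff.2 hF, hF0] with t hle h2 h3 h4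
    refine ENNReal.ofReal_le_ofReal ?_
    by_cases ht : t ∈ ⋃ k, B k
    · obtain ⟨k, hk⟩ := mem_iUnion.1 ht
      refine le_trans ?_ (h2 k hk)
      rw [h3 k hk, normalizedBump, indicator_of_mem hk, abs_div_mul_rpow (hpos k) hδ.le (p.pos t)]
      refine mul_le_mul_of_nonneg_right ?_ (inv_nonneg.2 (hpos k).le)
      -- The base is at most one by `hc`, so the larger exponent `p t` gives the smaller power.
      exact Real.rpow_le_rpow_of_exponent_ge_of_imp (by positivity) (hc k) hle
        (fun _ h0 => absurd h0 (p.pos t).ne')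
    · rw [h4 ht, zero_div, mul_zero, abs_zero, Real.zero_rpow (p.pos t).ne',
        Real.zero_rpow (q.pos t).ne']
  have h2 : luxemburgNorm p μ F ≤ r / δ := by
    refine luxemburgNorm_le (by positivity) (le_trans (le_of_eq ?_) (h1.trans hr1))
    congr 1
    funext t
    field_simp
  rwa [le_div_iff₀' hδ] at h2

/-- If the sets `B k` are disjoint, of positive measure, and `μ(B k)^{1/q - 1/p}` is bounded below
on `B k` uniformly in `k`, then the inclusion `L^{p(·)} ↪ L^{q(·)}` is not DSS. -/
theorem not_isDSS_inclusion [IsFiniteMeasure μ] (hqp : ∀ᵐ t ∂μ, q t ≤ p t)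
    {B : ℕ → Set Ω} (hB : ∀ k, MeasurableSet (B k)) (hd : Pairwise fun i j => Disjoint (B i) (B j))
    (hpos : ∀ k, 0 < μ.real (B k)) {δ : ℝ} (hδ : 0 < δ)
    (h : ∀ k, ∀ᵐ t ∂μ, t ∈ B k → δ ≤ μ.real (B k) ^ ((p t - q t) / (p t * q t))) :
    ¬ IsDSS (inclusion hqp) := by
  intro hD
  let g : ℕ → Ω →ₘ[μ] ℝ := fun k =>
    AEEqFun.mk (normalizedBump p μ (B k)) (measurable_normalizedBump (hB k)).aestronglyMeasurable
  have hg : ∀ k, g k =ᵐ[μ] normalizedBump p μ (B k) := fun k => AEEqFun.coeFn_mk _ _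
  have hgmod : ∀ k, modular p μ (g k) = 1 := fun k => by
    rw [← modular_normalizedBump (p := p) (hB k) (hpos k)]
    exact modular_congr ((hg k).mono fun t ht => by rw [ht])
  have hgmem : ∀ k, g k ∈ varLp p μ := fun k =>
    ⟨1, one_pos, by simp only [div_one]; rw [hgmod k]; exact ENNReal.one_lt_top⟩
  have hvanish : ∀ i j, i ≠ j → ∀ t ∈ B i, normalizedBump p μ (B j) t = 0 := fun i j hij t ht =>
    indicator_of_notMem (disjoint_left.1 (hd hij) ht) _
  refine hD (fun k => ⟨g k, hgmem k⟩) (fun k => ?_) (fun i j hij => ?_) ⟨δ, hδ, ?_⟩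
  · rw [norm_def]
    exact luxemburgNorm_eq_one_of_modular_eq_one (hgmod k)
  · refine Subtype.ext ?_
    change |g i| ⊓ |g j| = 0
    refine AEEqFun.ext ?_
    filter_upwards [AEEqFun.coeFn_inf |g i| |g j|, AEEqFun.coeFn_abs (g i),
      AEEqFun.coeFn_abs (g j), hg i, hg j, AEEqFun.coeFn_zero (α := Ω) (μ := μ) (β := ℝ)]
      with t h1 h2 h3 h4 h5 h6
    rw [h1, h2, h3, h4, h5, h6, Pi.zero_apply]
    by_cases ht : t ∈ B i
    · rw [hvanish i j hij t ht, abs_zero]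
      exact inf_eq_right.2 (abs_nonneg _)
    · rw [normalizedBump, indicator_of_notMem ht, abs_zero]
      exact inf_eq_left.2 (abs_nonneg _)
  -- `W` only has to contain the algebraic span. The norm inequality then passes to the closure
  -- because it defines a closed set, so limits need not be described.
  · let W : Submodule ℝ (varLp p μ) :=
      { carrier := {F | (∀ k, ∃ a : ℝ, ∀ᵐ t ∂μ, t ∈ B k →
            (F : Ω →ₘ[μ] ℝ) t = a * normalizedBump p μ (B k) t) ∧
          ∀ᵐ t ∂μ, t ∉ ⋃ k, B k → (F : Ω →ₘ[μ] ℝ) t = 0}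
        zero_mem' := by
          refine ⟨fun k => ⟨0, ?_⟩, ?_⟩ <;>
          filter_upwards [AEEqFun.coeFn_zero (α := Ω) (μ := μ) (β := ℝ)] with t ht _ <;>
          simp [ht]
        add_mem' := by
          rintro F G ⟨hF, hF0⟩ ⟨hG, hG0⟩
          have hadd := AEEqFun.coeFn_add (F : Ω →ₘ[μ] ℝ) (G : Ω →ₘ[μ] ℝ)
          refine ⟨fun k => ?_, ?_⟩
          · obtain ⟨a, ha⟩ := hF k
            obtain ⟨b, hb⟩ := hG k
            refine ⟨a + b, ?_⟩
            filter_upwards [hadd, ha, hb] with t h1 h2 h3 ht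
            rw [Submodule.coe_add, h1, Pi.add_apply, h2 ht, h3 ht, add_mul]
          · filter_upwards [hadd, hF0, hG0] with t h1 h2 h3 ht
            rw [Submodule.coe_add, h1, Pi.add_apply, h2 ht, h3 ht, add_zero]
        smul_mem' := by
          rintro c F ⟨hF, hF0⟩
          have hsmul := AEEqFun.coeFn_smul c (F : Ω →ₘ[μ] ℝ)
          refine ⟨fun k => ?_, ?_⟩
          · obtain ⟨a, ha⟩ := hF k
            refine ⟨c * a, ?_⟩
            filter_upwards [hsmul, ha] with t h1 h2 ht
            rw [Submodule.coe_smul, h1, Pi.smul_apply, h2 ht, smul_eq_mul, mul_assoc]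
          · filter_upwards [hsmul, hF0] with t h1 h2 ht
            rw [Submodule.coe_smul, h1, Pi.smul_apply, h2 ht, smul_zero] }
    have hspan : Submodule.span ℝ (range fun k => (⟨g k, hgmem k⟩ : varLp p μ)) ≤ W := by
      rw [Submodule.span_le]
      rintro _ ⟨j, rfl⟩
      refine ⟨fun k => ?_, ?_⟩
      · by_cases hkj : k = j
        · subst hkj
          exact ⟨1, (hg k).mono fun t ht _ => by rw [one_mul]; exact ht⟩
        · exact ⟨0, (hg j).mono fun t ht htk => by
            rw [zero_mul]; exact ht.trans (hvanish k j hkj t htk)⟩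
      · exact (hg j).mono fun t ht hn =>
          ht.trans (indicator_of_notMem (fun hj => hn (mem_iUnion.2 ⟨j, hj⟩)) _)
    have hclosed : IsClosed {F : varLp p μ | δ * ‖F‖ ≤ ‖inclusion hqp F‖} :=
      isClosed_le (continuous_const.mul continuous_norm) (inclusion hqp).continuous.norm
    refine fun F hF => closure_minimal (fun G hG => ?_) hclosed hF
    obtain ⟨hG1, hG0⟩ := hspan hG
    choose a ha using hG1
    exact luxemburgNorm_le_of_normalizedBump hqp hB hpos hδ h ha hG0 (inclusion hqp G).2

/-! ### Disjoint sets on which `μ(B k) ^ |f|` is bounded below -/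

theorem pairwise_disjoint_diff_succ {α : Type*} {A : ℕ → Set α} (hA : Antitone A) :
    Pairwise fun i j => Disjoint (A i \ A (i + 1)) (A j \ A (j + 1)) :=
  (pairwise_disjoint_on _).2 fun _ _ hij =>
    disjoint_left.2 fun _ hi hj => hi.2 (hA (Nat.succ_le_of_lt hij) hj.1)

/-- In an atomless measure space, every set of positive measure contains infinitely many disjoint
sets of positive measure. -/
theorem IsAtomless.exists_disjoint_seq (hatom : IsAtomless μ) {Z : Set Ω} (hZ : MeasurableSet Z)
    (hpos : 0 < μ Z) : ∃ B : ℕ → Set Ω, (∀ k, MeasurableSet (B k)) ∧ (∀ k, B k ⊆ Z) ∧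
      (∀ k, 0 < μ (B k)) ∧ Pairwise fun i j => Disjoint (B i) (B j) := by
  choose! T hTS hTm hT0 hTlt using hatom
  -- The iterated subsets have strictly decreasing measure, so successive differences have positive
  -- measure.
  let A : ℕ → Set Ω := fun k => T^[k] Z
  have hsucc : ∀ k, A (k + 1) = T (A k) := fun k => Function.iterate_succ_apply' T k Z
  have hA : ∀ k, MeasurableSet (A k) ∧ 0 < μ (A k) := fun k => by
    induction k with
    | zero => exact ⟨hZ, hpos⟩
    | succ k ih => rw [hsucc]; exact ⟨hTm _ ih.1 ih.2, hT0 _ ih.1 ih.2⟩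
  have hanti : Antitone A := antitone_nat_of_succ_le fun k => by
    rw [hsucc]; exact hTS _ (hA k).1 (hA k).2
  refine ⟨fun k => A k \ A (k + 1), fun k => (hA k).1.diff (hA _).1,
    fun k => sdiff_subset.trans (hanti k.zero_le), fun k => ?_, pairwise_disjoint_diff_succ hanti⟩
  refine (tsub_pos_of_lt ?_).trans_le (le_measure_sdiff (μ := μ))
  rw [hsucc]; exact hTlt _ (hA k).1 (hA k).2

/-- If the sublevel sets `{|f| ≤ s}` satisfy `ε ≤ y ^ s` for some `y ≤ μ {|f| ≤ s}` arbitrarily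
close to `0`, there are disjoint sets `B k` on which `μ(B k) ^ |f|` is bounded below. -/
theorem IsAtomless.exists_disjoint_seq_le_rpow [IsFiniteMeasure μ] (hatom : IsAtomless μ)
    {f : Ω → ℝ} (hf : Measurable f) (hf1 : ∀ᵐ t ∂μ, |f t| ≤ 1) {ε : ℝ} (hε : 0 < ε)
    (h : ∀ η > 0, ∃ y s : ℝ, 0 < y ∧ y < η ∧ y ≤ μ.real {t | |f t| ≤ s} ∧ ε ≤ y ^ s) :
    ∃ (B : ℕ → Set Ω) (δ : ℝ), 0 < δ ∧ (∀ k, MeasurableSet (B k)) ∧ (∀ k, 0 < μ.real (B k)) ∧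
      (Pairwise fun i j => Disjoint (B i) (B j)) ∧
      ∀ k, ∀ᵐ t ∂μ, t ∈ B k → δ ≤ μ.real (B k) ^ |f t| := by
  have hm : ∀ s, MeasurableSet {t | |f t| ≤ s} := fun s => measurableSet_le hf.abs measurable_const
  have hmono : ∀ s s' : ℝ, s ≤ s' → {t | |f t| ≤ s} ⊆ {t | |f t| ≤ s'} :=
    fun s s' hs t ht => le_trans (show |f t| ≤ s from ht) hs
  rcases (zero_le (a := μ {t | |f t| ≤ 0})).eq_or_lt with hZ | hZ
  · have hlim : Tendsto (fun s => μ.real {t | |f t| ≤ s}) (𝓝[>] 0) (𝓝 0) := by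
      have h1 := tendsto_measure_biInter_gt (μ := μ) (s := fun s : ℝ => {t | |f t| ≤ s}) (a := 0)
        (fun s _ => (hm s).nullMeasurableSet) (fun i j _ hij => hmono i j hij)
        ⟨1, one_pos, measure_ne_top _ _⟩
      have h2 : ⋂ s > (0 : ℝ), {t | |f t| ≤ s} = {t | |f t| ≤ 0} := by
        ext t
        simp only [mem_iInter, mem_ofPred_eq]
        exact ⟨fun h => le_of_forall_gt_imp_ge_of_dense h, fun h s hs => h.trans hs.le⟩
      rw [h2, ← hZ] at h1
      exact (ENNReal.tendsto_toReal ENNReal.zero_ne_top).comp h1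
    let good : ℝ → Prop := fun s =>
      ∃ y : ℝ, 0 < y ∧ y < 1 ∧ y ≤ μ.real {t | |f t| ≤ s} ∧ ε ≤ y ^ s
    have hgood : ∀ a > 0, ∃ s, good s ∧ μ.real {t | |f t| ≤ s} < a := fun a ha => by
      obtain ⟨σ, hσa, hσ⟩ := ((hlim.eventually_lt_const ha).and self_mem_nhdsWithin).exists
      have hσ : 0 < σ := hσ
      -- With `y < ε ^ (1/σ)` one has `y ^ σ < ε ≤ y ^ s`. As `y < 1`, this forces `s ≤ σ`: small
      -- `y` means a small level.
      obtain ⟨y, s, hy0, hy, hys, hεy⟩ := h (min 1 (ε ^ σ⁻¹)) (by positivity)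
      refine ⟨s, ⟨y, hy0, hy.trans_le (min_le_left _ _), hys, hεy⟩, lt_of_le_of_lt ?_ hσa⟩
      refine measureReal_mono (hmono _ _ ?_)
      by_contra! hlt
      have h1 : y ^ s < y ^ σ :=
        Real.rpow_lt_rpow_of_exponent_gt hy0 (hy.trans_le (min_le_left _ _)) hlt
      have h2 : y ^ σ < ε := by
        calc y ^ σ < (ε ^ σ⁻¹) ^ σ :=
              Real.rpow_lt_rpow hy0.le (hy.trans_le (min_le_right _ _)) hσ
          _ = ε := Real.rpow_inv_rpow hε.le hσ.ne'
      linarith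
    have hgood_pos : ∀ s, good s → 0 < μ.real {t | |f t| ≤ s} :=
      fun s ⟨y, hy0, _, hy, _⟩ => hy0.trans_le hy
    obtain ⟨s₀, hs₀, -⟩ := hgood 1 one_pos
    -- Halving the measure at each step leaves every difference at least half of its sublevel set,
    -- hence of measure at least `y / 2`.
    have hstep : ∀ s, good s →
        ∃ s', good s' ∧ μ.real {t | |f t| ≤ s'} < μ.real {t | |f t| ≤ s} / 2 :=
      fun s hs => hgood _ (half_pos (hgood_pos s hs))
    choose! T hT hTlt using hstep
    let S : ℕ → ℝ := fun k => T^[k] s₀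
    have hsucc : ∀ k, S (k + 1) = T (S k) := fun k => Function.iterate_succ_apply' T k s₀
    have hS : ∀ k, good (S k) := fun k => by
      induction k with
      | zero => exact hs₀
      | succ k ih => rw [hsucc]; exact hT _ ih
    have hlt : ∀ k, μ.real {t | |f t| ≤ S (k + 1)} < μ.real {t | |f t| ≤ S k} / 2 := fun k => by
      rw [hsucc]; exact hTlt _ (hS k)
    have hanti : Antitone fun k => {t | |f t| ≤ S k} := antitone_nat_of_succ_le fun k => by
      refine hmono _ _ (le_of_not_gt fun hk => ?_)
      have h1 := measureReal_mono (μ := μ) (hmono _ _ hk.le)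
      have h2 := hlt k
      have h3 := hgood_pos _ (hS k)
      linarith
    have hhalf : ∀ k, μ.real {t | |f t| ≤ S k} / 2 ≤
        μ.real ({t | |f t| ≤ S k} \ {t | |f t| ≤ S (k + 1)}) := fun k => by
      rw [measureReal_sdiff (hanti k.le_succ) (hm _)]
      linarith [hlt k]
    refine ⟨fun k => {t | |f t| ≤ S k} \ {t | |f t| ≤ S (k + 1)}, ε / 2, half_pos hε,
      fun k => (hm _).diff (hm _), fun k => (half_pos (hgood_pos _ (hS k))).trans_le (hhalf k),
      pairwise_disjoint_diff_succ hanti, fun k => ?_⟩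
    obtain ⟨y, hy0, hy1, hy, hεy⟩ := hS k
    filter_upwards [hf1] with t ht1 ht
    -- On the difference `|f t| ≤ S k` bounds `y ^ |f t|` below, and `|f t| ≤ 1` makes the loss from
    -- halving at most a factor `1/2`.
    calc ε / 2 ≤ y ^ S k * (1 / 2) ^ (1 : ℝ) := by rw [Real.rpow_one]; linarith
      _ ≤ y ^ |f t| * (1 / 2) ^ |f t| := by
          gcongr ?_ * ?_
          · exact Real.rpow_le_rpow_of_exponent_ge hy0 hy1.le ht.1
          · exact Real.rpow_le_rpow_of_exponent_ge (by norm_num) (by norm_num) ht1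
      _ = (y * (1 / 2)) ^ |f t| := (Real.mul_rpow hy0.le (by norm_num)).symm
      _ ≤ _ := Real.rpow_le_rpow (by positivity) (by linarith [hhalf k]) (abs_nonneg _)
  · obtain ⟨B, hB, hBZ, hpos, hd⟩ := hatom.exists_disjoint_seq (hm 0) hZ
    refine ⟨B, 1, one_pos, hB, fun k => ENNReal.toReal_pos (hpos k).ne' (measure_ne_top _ _), hd,
      fun k => Eventually.of_forall fun t ht => ?_⟩
    rw [le_antisymm (hBZ k ht) (abs_nonneg _), Real.rpow_zero]

/-! ### From the rearrangement to sublevel sets, and the conclusion -/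

/-- If the decreasing rearrangement of `f` at `x` is less than `s`, then `{|f| ≤ s}` has measure at
least `μ(Ω) - x`. -/
theorem sub_le_measureReal_of_decreasingRearrangement_lt [IsFiniteMeasure μ] {f : Ω → ℝ}
    (hf : Measurable f) {C : ℝ} (hC : 0 ≤ C) (hfC : ∀ᵐ t ∂μ, |f t| ≤ C) {x s : ℝ} (hx : 0 ≤ x)
    (hs : decreasingRearrangement μ f x < s) :
    μ.real univ - x ≤ μ.real {t | |f t| ≤ s} := by
  -- Nonemptiness rules out the default value `sInf ∅ = 0`; the essential bound `C` is a member.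
  have hne : {s : ℝ | 0 ≤ s ∧ distributionFunction μ f s ≤ ENNReal.ofReal x}.Nonempty := by
    refine ⟨C, hC, ?_⟩
    have : distributionFunction μ f C = 0 :=
      measure_mono_null (fun t ht => not_le.2 ht) (ae_iff.1 hfC)
    rw [this]
    exact zero_le
  obtain ⟨s', ⟨-, hs'⟩, hlt⟩ := exists_lt_of_csInf_lt hne hs
  have h1 : μ.real {t | |f t| ≤ s}ᶜ ≤ x := by
    refine ENNReal.toReal_le_of_le_ofReal hx (le_trans (measure_mono fun t ht => ?_) hs')
    exact hlt.trans (not_le.1 ht)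
  have h2 := measureReal_add_measureReal_compl (μ := μ)
    (measurableSet_le hf.abs (measurable_const (a := s)))
  linarith

end VariableLebesgue

theorem proposition3p3 {Ω : Type*} [MeasurableSpace Ω] (μ : Measure Ω) [IsFiniteMeasure μ]
    (hμ : μ ≠ 0) (hatom : VariableLebesgue.IsAtomless μ)
    (p q : VariableLebesgue.Exponent Ω) (hqp : ∀ᵐ t ∂μ, q t ≤ p t)
    (hDSS : VariableLebesgue.IsDSS (VariableLebesgue.inclusion hqp)) :
    Tendsto
      (fun x : ℝ => (μ.real univ - x) ^
        VariableLebesgue.decreasingRearrangement μ (fun t => (p t - q t) / (p t * q t)) x)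
      (𝓝[<] (μ.real univ)) (𝓝 0) := by
  set f : Ω → ℝ := fun t => (p t - q t) / (p t * q t) with hf_def
  have hf : Measurable f := (p.measurable.sub q.measurable).div (p.measurable.mul q.measurable)
  have hf0 : ∀ᵐ t ∂μ, |f t| = f t := by
    filter_upwards [hqp] with t ht
    exact abs_of_nonneg (div_nonneg (sub_nonneg.2 ht) (mul_pos (p.pos t) (q.pos t)).le)
  have hf1 : ∀ᵐ t ∂μ, |f t| ≤ 1 := by
    filter_upwards [hf0] with t ht
    rw [ht, div_le_one (mul_pos (p.pos t) (q.pos t))]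
    nlinarith [p.pos t, q.one_le t]
  have hM : 0 < μ.real univ :=
    ENNReal.toReal_pos (Measure.measure_univ_ne_zero.2 hμ) (measure_ne_top _ _)
  by_contra hlim
  rw [Metric.tendsto_nhds] at hlim
  push Not at hlim
  obtain ⟨ε, hε, hfreq⟩ := hlim
  obtain ⟨B, δ, hδ, hB, hpos, hd, hle⟩ := hatom.exists_disjoint_seq_le_rpow hf hf1 (half_pos hε)
    fun η hη => by
      have hnear : ∀ᶠ x in 𝓝[<] (μ.real univ), x ∈ Ioo (max 0 (μ.real univ - η)) (μ.real univ) :=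
        Ioo_mem_nhdsLT (max_lt hM (sub_lt_self _ hη))
      obtain ⟨x, hx, hxmem⟩ := (hfreq.and_eventually hnear).exists
      have hx0 : 0 < x := (le_max_left _ _).trans_lt hxmem.1
      have hxη : μ.real univ - η < x := (le_max_right _ _).trans_lt hxmem.1
      have hy : 0 < μ.real univ - x := sub_pos.2 hxmem.2
      rw [Real.dist_eq, sub_zero, abs_of_nonneg (Real.rpow_nonneg hy.le _)] at hx
      -- The sublevel estimate needs `s` strictly above the rearrangement. Continuity in the
      -- exponent permits this at the cost of replacing `ε` by `ε / 2`.
      have hcont : ContinuousAt (fun s : ℝ => (μ.real univ - x) ^ s)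
          (VariableLebesgue.decreasingRearrangement μ f x) :=
        Real.continuousAt_const_rpow hy.ne'
      have hev := hcont.eventually_const_lt ((half_lt_self hε).trans_le hx)
      obtain ⟨s, hs, hlt⟩ :=
        ((hev.filter_mono nhdsWithin_le_nhds).and
          (self_mem_nhdsWithin (s := Ioi (VariableLebesgue.decreasingRearrangement μ f x)))).exists
      exact ⟨μ.real univ - x, s, hy, by linarith,
        VariableLebesgue.sub_le_measureReal_of_decreasingRearrangement_lt hf zero_le_one hf1
          hx0.le hlt, hs.le⟩
  refine VariableLebesgue.not_isDSS_inclusion hqp hB hd hpos hδ (fun k => ?_) hDSS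
  filter_upwards [hle k, hf0] with t h1 h2 ht
  have h3 := h1 ht
  rwa [h2] at h3
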